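/- Let $\boldsymbol\lambda=\{\lambda_n\}_{n=0}^\infty$ be a bounded sequence of positive real numbers and let $W_{\boldsymbol\lambda}$ be the unilateral weighted shift on $\ell^2$ with weights $\boldsymbol\lambda$, i.e. the bounded operator with $W_{\boldsymbol\lambda}e_n=\lambda_n e_{n+1}$ for all $n\ge 0$, where $\{e_n\}_{n=0}^\infty$ is the standard orthonormal basis. Put $\hat\lambda_0=1$ and $\hat\lambda_n=\lambda_0^2\cdots\lambda_{n-1}^2$ for $n\ge 1$, let $\mathbb R_+=[0,\infty)$, and define the polynomials $Q_0=Q_1=0$ and $Q_n(x)=\sum_{j=0}^{n-2}(n-j-1)x^j$ for $n\ge 2$. Assume that $W_{\boldsymbol\lambda}$ is conditionally positive definite (CPD): for every $h\in\ell^2$ the sequence $\gamma_n=\|W_{\boldsymbol\lambda}^n h\|^2$ satisfies $\sum_{i,j=0}^k\gamma_{i+j}z_i\bar z_j\ge 0$ for all $k\ge 0$ and all $z_0,\dots,z_k\in\mathbb C$ with $\sum_{j=0}^k z_j=0$. Let $(b,c,\nu)$ be the scalar representing triplet of $W_{\boldsymbol\lambda}$: $b\in\mathbb R$, $c\ge 0$,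 and $\nu$ is a compactly supported finite (positive) Borel measure on $\mathbb R_+$ with $\nu(\{1\})=0$ and $$\hat\lambda_n=1+bn+cn^2+\int_{\mathbb R_+}Q_n\,d\nu,\qquad n\ge 0 .$$ Let $(B,C,F)$ be the operator representing triplet of $W_{\boldsymbol\lambda}$: $B,C$ are bounded operators on $\ell^2$ with $B=B^*$ and $C\ge 0$, and $F$ is a compactly supported semispectral measure on $\mathbb R_+$ (a map from the Borel subsets of $\mathbb R_+$ to the bounded operators on $\ell^2$ such that $\langle F(\cdot)h,h\rangle$ is a measure for every $h\in\ell^2$) with $F(\{1\})=0$ and $$W_{\boldsymbol\lambda}^{*n}W_{\boldsymbol\lambda}^{n}=I+nB+n^2C+\int_{\mathbb R_+}Q_n\,dF,\qquad n\ge 0,$$ where the integral is taken in the weak sense: $\langle(\int Q_n\,dF)h,h\rangle=\int Q_n\,d\langle F(\cdot)h,h\rangle$ for all $h\in\ell^2$. If $\sup\operatorname{supp}\nu>1$ and $1\notin\operatorname{supp}\nu$, where $\operatorname{supp}\nu$ is the closed support of $\nu$, then the operator $F(\mathbb R_+)$ is not compact. -/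

import Mathlib

noncomputable section

open MeasureTheory
open scoped NNReal ComplexOrder

namespace CPDShift

/-- The polynomials `Q_n(x) = ∑_{j=0}^{n-2} (n - j - 1) x^j`, with `Q_0 = Q_1 = 0`. -/
def Q (n : ℕ) (x : ℝ) : ℝ := ∑ j ∈ Finset.range (n - 1), ((n : ℝ) - j - 1) * x ^ j

/-- Conditionally positive definite real sequences. -/
def IsCPDSeq (γ : ℕ → ℝ) : Prop :=
  ∀ (k : ℕ) (z : ℕ → ℂ), ∑ j ∈ Finset.range (k + 1), z j = 0 →
    0 ≤ ∑ i ∈ Finset.range (k + 1), ∑ j ∈ Finset.range (k + 1),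
      (γ (i + j) : ℂ) * z i * (starRingEnd ℂ) (z j)

section Operators

variable {H : Type*} [NormedAddCommGroup H] [InnerProductSpace ℂ H] [CompleteSpace H]

/-- Conditionally positive definite operators. -/
def IsCPDOperator (T : H →L[ℂ] H) : Prop :=
  ∀ h : H, IsCPDSeq fun n => ‖(T ^ n) h‖ ^ 2

end Operators

/-- A semispectral measure on `X`: a `B(H)`-valued map `F` on the measurable subsets of `X` such
that `⟨F(·)h, h⟩` is a measure for every `h`. As for Mathlib's vector measures, the value on a
non-measurable set is `0` by convention. -/
structure SemispectralMeasure (X : Type*) [MeasurableSpace X] (H : Type*)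
    [NormedAddCommGroup H] [InnerProductSpace ℂ H] where
  toFun : Set X → H →L[ℂ] H
  not_measurable : ∀ s, ¬ MeasurableSet s → toFun s = 0
  exists_measure : ∀ h : H, ∃ μ : Measure X, IsFiniteMeasure μ ∧
    ∀ s, MeasurableSet s → inner ℂ h (toFun s h) = (μ.real s : ℂ)

namespace SemispectralMeasure

variable {X : Type*} [MeasurableSpace X] {H : Type*} [NormedAddCommGroup H]
  [InnerProductSpace ℂ H]

instance : CoeFun (SemispectralMeasure X H) (fun _ => Set X → H →L[ℂ] H) := ⟨toFun⟩

/-- The (unique) scalar measure `⟨F(·)h, h⟩`. -/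
def scalarMeasure (F : SemispectralMeasure X H) (h : H) : Measure X :=
  (F.exists_measure h).choose

theorem isFiniteMeasure_scalarMeasure (F : SemispectralMeasure X H) (h : H) :
    IsFiniteMeasure (F.scalarMeasure h) :=
  (F.exists_measure h).choose_spec.1

theorem inner_eq_scalarMeasure (F : SemispectralMeasure X H) (h : H) {s : Set X}
    (hs : MeasurableSet s) : inner ℂ h (F s h) = ((F.scalarMeasure h).real s : ℂ) :=
  (F.exists_measure h).choose_spec.2 s hs

/-- The closed support: the points all of whose open neighbourhoods have nonzero measure. -/
def support [TopologicalSpace X] (F : SemispectralMeasure X H) : Set X :=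
  {x | ∀ U : Set X, IsOpen U → x ∈ U → F U ≠ 0}

/-- `A` is the operator integral `∫ f dF`, i.e. `⟨A h, h⟩ = ∫ f d⟨F(·)h, h⟩` for every `h`. -/
def HasIntegral (F : SemispectralMeasure X H) (f : X → ℝ) (A : H →L[ℂ] H) : Prop :=
  ∀ h : H, Integrable f (F.scalarMeasure h) ∧
    inner ℂ h (A h) = ((∫ x, f x ∂(F.scalarMeasure h) : ℝ) : ℂ)

end SemispectralMeasure

/-- `(B, C, F)` is the (operator) representing triplet of `T`. -/
structure IsRepresentingTriplet {H : Type*} [NormedAddCommGroup H] [InnerProductSpace ℂ H]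
    [CompleteSpace H] (T B C : H →L[ℂ] H) (F : SemispectralMeasure ℝ≥0 H) : Prop where
  selfAdjoint : IsSelfAdjoint B
  positive : C.IsPositive
  compact_support : IsCompact F.support
  singleton_one : F {1} = 0
  formula : ∀ n : ℕ, ∃ A : H →L[ℂ] H, F.HasIntegral (fun x => Q n (x : ℝ)) A ∧
    (ContinuousLinearMap.adjoint T) ^ n * T ^ n = 1 + (n : ℂ) • B + ((n : ℂ) ^ 2) • C + A

/-- The Hilbert space `ℓ²` of square summable complex sequences. -/
abbrev Ell2 : Type := lp (fun _ : ℕ => ℂ) 2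

/-- The standard orthonormal basis of `ℓ²`. -/
def e (n : ℕ) : Ell2 := lp.single 2 n (1 : ℂ)

/-- The action of the weighted shift on sequences. -/
def shiftSeq (l : ℕ → ℝ) (x : ℕ → ℂ) : ℕ → ℂ
  | 0 => 0
  | n + 1 => (l n : ℂ) * x n

theorem norm_shiftSeq_le {l : ℕ → ℝ} {M : ℝ} (hpos : ∀ n, 0 < l n) (hM : ∀ n, l n ≤ M)
    (x : ℕ → ℂ) (n : ℕ) : ‖shiftSeq l x (n + 1)‖ ^ 2 ≤ M ^ 2 * ‖x n‖ ^ 2 := by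
  have h : ‖shiftSeq l x (n + 1)‖ = l n * ‖x n‖ := by
    simp [shiftSeq, abs_of_pos (hpos n)]
  rw [h, mul_pow]
  have := (hpos n).le
  gcongr
  exact hM n

theorem ell2_summable (x : Ell2) : Summable fun n => ‖x n‖ ^ 2 := by
  have := (memℓp_gen_iff (p := 2) (by simp)).1 (lp.memℓp x)
  simpa using this

theorem summable_shiftSeq {l : ℕ → ℝ} {M : ℝ} (hpos : ∀ n, 0 < l n) (hM : ∀ n, l n ≤ M)
    (x : Ell2) : Summable fun n => ‖shiftSeq l x n‖ ^ 2 := by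
  rw [← summable_nat_add_iff 1]
  exact Summable.of_nonneg_of_le (fun _ => by positivity) (norm_shiftSeq_le hpos hM x)
    ((ell2_summable x).mul_left _)

theorem memℓp_shiftSeq {l : ℕ → ℝ} (hpos : ∀ n, 0 < l n) (hbdd : BddAbove (Set.range l))
    (x : Ell2) : Memℓp (E := fun _ : ℕ => ℂ) (shiftSeq l x) 2 := by
  obtain ⟨M, hM⟩ := hbdd
  have hM' : ∀ n, l n ≤ M := fun n => hM ⟨n, rfl⟩
  exact (memℓp_gen_iff (p := 2) (by simp)).2 (by simpa using summable_shiftSeq hpos hM' x)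

/-- The weighted shift as a linear map on `ℓ²`. -/
def weightedShiftLin (l : ℕ → ℝ) (hpos : ∀ n, 0 < l n) (hbdd : BddAbove (Set.range l)) :
    Ell2 →ₗ[ℂ] Ell2 where
  toFun x := ⟨shiftSeq l x, memℓp_shiftSeq hpos hbdd x⟩
  map_add' x y := by
    ext n
    change shiftSeq l (x + y) n = shiftSeq l x n + shiftSeq l y n
    cases n with
    | zero => simp [shiftSeq]
    | succ n => simp [shiftSeq, mul_add]
  map_smul' a x := by
    ext n
    cases n with
    | zero => simp [shiftSeq]
    | succ n => simp [shiftSeq, mul_left_comm]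

theorem ell2_norm_sq (x : Ell2) : ‖x‖ ^ 2 = ∑' n, ‖x n‖ ^ 2 := by
  have := lp.norm_rpow_eq_tsum (p := 2) (by simp) x
  simpa using this

theorem exists_bound_weightedShiftLin (l : ℕ → ℝ) (hpos : ∀ n, 0 < l n)
    (hbdd : BddAbove (Set.range l)) :
    ∃ M : ℝ, ∀ x, ‖weightedShiftLin l hpos hbdd x‖ ≤ M * ‖x‖ := by
  obtain ⟨M, hM⟩ := id hbdd
  have hM' : ∀ n, l n ≤ M := fun n => hM ⟨n, rfl⟩
  have hM0 : 0 ≤ M := (hpos 0).le.trans (hM' 0)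
  refine ⟨M, fun x => ?_⟩
  refine le_of_sq_le_sq ?_ (by positivity)
  rw [mul_pow, ell2_norm_sq, ell2_norm_sq, ← tsum_mul_left]
  have hs := summable_shiftSeq hpos hM' x
  change ∑' n, ‖shiftSeq l x n‖ ^ 2 ≤ _
  rw [hs.tsum_eq_zero_add]
  simp only [shiftSeq, norm_zero]
  rw [zero_pow two_ne_zero, zero_add]
  exact Summable.tsum_le_tsum (norm_shiftSeq_le hpos hM' x) ((summable_nat_add_iff 1).2 hs)
    ((ell2_summable x).mul_left _)

/-- The bounded unilateral weighted shift on `ℓ²` with weights `l`. -/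
def weightedShift (l : ℕ → ℝ) (hpos : ∀ n, 0 < l n) (hbdd : BddAbove (Set.range l)) :
    Ell2 →L[ℂ] Ell2 :=
  (weightedShiftLin l hpos hbdd).mkContinuousOfExistsBound
    (exists_bound_weightedShiftLin l hpos hbdd)

theorem weightedShift_e (l : ℕ → ℝ) (hpos : ∀ n, 0 < l n) (hbdd : BddAbove (Set.range l))
    (n : ℕ) : weightedShift l hpos hbdd (e n) = (l n : ℂ) • e (n + 1) := by
  ext m
  change shiftSeq l (e n) m = (l n : ℂ) * e (n + 1) m
  cases m with
  | zero => simp [shiftSeq, e]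
  | succ m =>
    by_cases h : m = n
    · subst h; simp [shiftSeq, e]
    · simp [shiftSeq, e, h]

/-- The sequence `l̂_n = l_0² ⋯ l_{n-1}²`, with `l̂_0 = 1`. -/
def hat (l : ℕ → ℝ) (n : ℕ) : ℝ := ∏ i ∈ Finset.range n, l i ^ 2

/-- `(b, c, ν)` is the scalar representing triplet of the weighted shift with weights `l`. -/
structure IsScalarTriplet (l : ℕ → ℝ) (b c : ℝ) (ν : Measure ℝ≥0) : Prop where
  nonneg : 0 ≤ c
  finite : IsFiniteMeasure ν
  compact_support : IsCompact ν.support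
  singleton_one : ν {1} = 0
  formula : ∀ n : ℕ, hat l n = 1 + b * n + c * (n : ℝ) ^ 2 + ∫ x : ℝ≥0, Q n (x : ℝ) ∂ν

end CPDShift

end

open MeasureTheory Filter Topology
open scoped NNReal InnerProductSpace

namespace CPDShift

/-! Fourth differences in `n` annihilate the quadratic parts of both triplet formulas and turn `Q n`
into `(x - 1)² xⁿ`. Since `‖Wⁿ e_m‖² = hat l (m + n) / hat l m`, comparing the two formulas gives
`hat l m * ∫ (x - 1)² d⟨F(·)e_m, e_m⟩ = ∫ (x - 1)² xᵐ dν`. As `1` is off `supp ν`, the right side is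
at least `ε ∫ xᵐ dν`. As `supp ν` passes `1`, these moments grow exponentially and dominate `hat l
m` (`exists_hat_le_mul_integral_pow`). As `F` has compact support, `(x - 1)²` is bounded there.
Hence `⟨F(ℝ₊)e_m, e_m⟩` is eventually bounded below, which no compact operator allows, `e_m` being
weakly null. -/

theorem Q_succ (n : ℕ) (x : ℝ) : Q (n + 1) x = Q n x + ∑ j ∈ Finset.range n, x ^ j := by
  cases n with
  | zero => simp [Q]
  | succ k =>
    simp only [Q, Nat.add_sub_cancel]
    rw [Finset.sum_range_succ, Finset.sum_range_succ (fun j => x ^ j), ← add_assoc,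
      ← Finset.sum_add_distrib]
    push_cast
    congr 1
    · exact Finset.sum_congr rfl fun j _ => by ring
    · ring

/-- Away from `x = 1` this bounds `Q n x` by a multiple of `xⁿ + n`. -/
theorem sq_mul_Q (n : ℕ) (x : ℝ) : (x - 1) ^ 2 * Q n x = x ^ n - 1 - n * (x - 1) := by
  induction n with
  | zero => simp [Q]
  | succ n ih =>
    have hg := mul_geom_sum x n
    rw [Q_succ, mul_add, ih, pow_two, mul_assoc, hg]
    push_cast
    ring

/-- The second difference of `Q` is `xⁿ`, and each further difference contributes a factor `x - 1`.
A third difference would already kill the quadratic terms, but `(x - 1) xⁿ` changes sign. -/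
theorem fourthDiff_Q (n : ℕ) (x : ℝ) :
    Q (n + 4) x - 4 * Q (n + 3) x + 6 * Q (n + 2) x - 4 * Q (n + 1) x + Q n x
      = (x - 1) ^ 2 * x ^ n := by
  simp only [Q_succ, Finset.sum_range_succ]
  ring

theorem integral_fourthDiff_Q {μ : Measure ℝ≥0}
    (hQ : ∀ n, Integrable (fun x : ℝ≥0 => Q n x) μ) (m : ℕ) :
    Integrable (fun x : ℝ≥0 => ((x : ℝ) - 1) ^ 2 * (x : ℝ) ^ m) μ ∧
    ∫ x : ℝ≥0, ((x : ℝ) - 1) ^ 2 * (x : ℝ) ^ m ∂μ =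
      ∫ x : ℝ≥0, Q (m + 4) x ∂μ - 4 * ∫ x : ℝ≥0, Q (m + 3) x ∂μ + 6 * ∫ x : ℝ≥0, Q (m + 2) x ∂μ
        - 4 * ∫ x : ℝ≥0, Q (m + 1) x ∂μ + ∫ x : ℝ≥0, Q m x ∂μ := by
  have j3 := (hQ (m + 3)).const_mul 4
  have j2 := (hQ (m + 2)).const_mul 6
  have j1 := (hQ (m + 1)).const_mul 4
  have k3 : Integrable (fun x : ℝ≥0 => Q (m + 4) x - 4 * Q (m + 3) x) μ := (hQ (m + 4)).sub j3
  have k2 : Integrable (fun x : ℝ≥0 => Q (m + 4) x - 4 * Q (m + 3) x + 6 * Q (m + 2) x) μ :=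
    k3.add j2
  have k1 : Integrable (fun x : ℝ≥0 => Q (m + 4) x - 4 * Q (m + 3) x + 6 * Q (m + 2) x
      - 4 * Q (m + 1) x) μ := k2.sub j1
  simp only [← fourthDiff_Q]
  refine ⟨k1.add (hQ m), ?_⟩
  rw [integral_add k1 (hQ m), integral_sub k2 j1, integral_add k3 j2, integral_sub (hQ (m + 4)) j3]
  simp only [integral_const_mul]

theorem continuous_Q (n : ℕ) : Continuous (Q n) := by
  unfold Q
  fun_prop

/-- A continuous function is integrable against a finite measure with compact support. -/
theorem integrable_of_isCompact_support {X : Type*} [TopologicalSpace X] [MeasurableSpace X]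
    [OpensMeasurableSpace X] [HereditarilyLindelofSpace X] [T2Space X]
    {μ : Measure X} [IsFiniteMeasure μ] (hμ : IsCompact μ.support) {f : X → ℝ}
    (hf : Continuous f) : Integrable f μ := by
  rw [← Measure.restrict_eq_self_of_ae_mem (Measure.support_mem_ae (μ := μ))]
  exact hf.continuousOn.integrableOn_compact hμ

/-- An operator whose diagonal entries are eventually bounded away from `0` is not compact. -/
theorem not_isCompactOperator_of_le_inner_e {T : Ell2 →L[ℂ] Ell2} {δ : ℝ} (hδ : 0 < δ)
    (h : ∀ᶠ m in atTop, δ ≤ (⟪e m, T (e m)⟫_ℂ).re) : ¬ IsCompactOperator T := by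
  intro hT
  have hnorm (m : ℕ) : ‖e m‖ = 1 := by simp [e, lp.norm_single]
  obtain ⟨K, hK, hTK⟩ := hT.image_closedBall_subset_compact (f := (T : Ell2 →ₗ[ℂ] Ell2)) 1
  have hmem (m : ℕ) : T (e m) ∈ K := hTK ⟨e m, by simp [hnorm], rfl⟩
  obtain ⟨y, -, φ, hφ, hlim⟩ := hK.tendsto_subseq hmem
  -- The limit `y` is a fixed `ℓ²` vector, so its coordinates tend to `0`; near the limit the
  -- diagonal entries of `T` are close to these coordinates.
  have hy : Tendsto (fun m => ‖y m‖) atTop (𝓝 0) := by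
    have := (ell2_summable y).tendsto_atTop_zero.sqrt
    simpa using this
  have hd : Tendsto (fun m => ‖T (e (φ m)) - y‖ + ‖y (φ m)‖) atTop (𝓝 0) := by
    have h1 := (tendsto_iff_norm_sub_tendsto_zero.1 hlim)
    simpa using h1.add (hy.comp hφ.tendsto_atTop)
  obtain ⟨m, hm1, hm2⟩ := ((hd.eventually_lt_const hδ).and (hφ.tendsto_atTop.eventually h)).exists
  have hin : ⟪e (φ m), y⟫_ℂ = y (φ m) := by simp [e, lp.inner_single_left]
  have : (⟪e (φ m), T (e (φ m))⟫_ℂ).re ≤ ‖T (e (φ m)) - y‖ + ‖y (φ m)‖ := by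
    calc (⟪e (φ m), T (e (φ m))⟫_ℂ).re ≤ ‖⟪e (φ m), T (e (φ m))⟫_ℂ‖ := Complex.re_le_norm _
      _ = ‖⟪e (φ m), T (e (φ m)) - y⟫_ℂ + y (φ m)‖ := by rw [inner_sub_right, hin, sub_add_cancel]
      _ ≤ ‖⟪e (φ m), T (e (φ m)) - y⟫_ℂ‖ + ‖y (φ m)‖ := norm_add_le _ _
      _ ≤ ‖e (φ m)‖ * ‖T (e (φ m)) - y‖ + ‖y (φ m)‖ := by gcongr; exact norm_inner_le_norm _ _
      _ = _ := by rw [hnorm, one_mul]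
  linarith

/-! ### Orbits of basis vectors, and semispectral measures. -/

theorem hat_pos {l : ℕ → ℝ} (hpos : ∀ n, 0 < l n) (n : ℕ) : 0 < hat l n :=
  Finset.prod_pos fun i _ => pow_pos (hpos i) 2

theorem norm_weightedShift_pow_e_sq (l : ℕ → ℝ) (hpos : ∀ n, 0 < l n)
    (hbdd : BddAbove (Set.range l)) (n m : ℕ) :
    hat l m * ‖(weightedShift l hpos hbdd ^ n) (e m)‖ ^ 2 = hat l (m + n) := by
  induction n generalizing m with
  | zero => simp [e, lp.norm_single]
  | succ n ih =>
    have hs : hat l m * l m ^ 2 = hat l (m + 1) := (Finset.prod_range_succ _ _).symm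
    rw [pow_succ (weightedShift l hpos hbdd), mul_apply_eq_comp, weightedShift_e, map_smul, norm_smul, mul_pow,
      ← mul_assoc, Complex.norm_real, Real.norm_eq_abs, sq_abs, hs, ih]
    congr 1
    ring

theorem inner_adjoint_pow_mul_pow {H : Type*} [NormedAddCommGroup H] [InnerProductSpace ℂ H]
    [CompleteSpace H] (T : H →L[ℂ] H) (n : ℕ) (h : H) :
    ⟪h, (ContinuousLinearMap.adjoint T ^ n * T ^ n) h⟫_ℂ = ((‖(T ^ n) h‖ ^ 2 : ℝ) : ℂ) := by
  rw [← ContinuousLinearMap.star_eq_adjoint, ← star_pow, ContinuousLinearMap.star_eq_adjoint,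
    mul_apply_eq_comp, ContinuousLinearMap.adjoint_inner_right,
    inner_self_eq_norm_sq_to_K]
  norm_cast

namespace SemispectralMeasure

variable {X : Type*} [MeasurableSpace X] {H : Type*} [NormedAddCommGroup H]
  [InnerProductSpace ℂ H]

theorem scalarMeasure_eq_zero (F : SemispectralMeasure X H) {s : Set X} (hs : MeasurableSet s)
    (h0 : F s = 0) (h : H) : F.scalarMeasure h s = 0 := by
  have := F.isFiniteMeasure_scalarMeasure h
  have := F.inner_eq_scalarMeasure h hs
  rw [h0] at this
  simp only [zero_apply, inner_zero_right] at this
  exact (measureReal_eq_zero_iff).1 (by exact_mod_cast this.symm)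

/-- Each point off the support has a null neighbourhood, and second countability makes their union
null. -/
theorem ae_mem_support [TopologicalSpace X] [OpensMeasurableSpace X] [SecondCountableTopology X]
    (F : SemispectralMeasure X H) (h : H) : ∀ᵐ x ∂F.scalarMeasure h, x ∈ F.support := by
  refine measure_null_of_locally_null _ fun x hx => ?_
  have : ∃ U : Set X, IsOpen U ∧ x ∈ U ∧ F U = 0 := by
    simpa [support] using hx
  obtain ⟨U, hU, hxU, h0⟩ := this
  exact ⟨U, mem_nhdsWithin_of_mem_nhds (hU.mem_nhds hxU),
    F.scalarMeasure_eq_zero hU.measurableSet h0 h⟩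

end SemispectralMeasure

/-- The fourth difference of `n ↦ ‖Tⁿ h‖²` at `0` is `∫ (x - 1)² d⟨F(·)h, h⟩`. -/
theorem IsRepresentingTriplet.integral_sub_one_sq {H : Type*} [NormedAddCommGroup H]
    [InnerProductSpace ℂ H] [CompleteSpace H] {T B C : H →L[ℂ] H} {F : SemispectralMeasure ℝ≥0 H}
    (hF : IsRepresentingTriplet T B C F) (h : H) :
    Integrable (fun x : ℝ≥0 => ((x : ℝ) - 1) ^ 2) (F.scalarMeasure h) ∧
    ∫ x : ℝ≥0, ((x : ℝ) - 1) ^ 2 ∂F.scalarMeasure h =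
      ‖(T ^ 4) h‖ ^ 2 - 4 * ‖(T ^ 3) h‖ ^ 2 + 6 * ‖(T ^ 2) h‖ ^ 2 - 4 * ‖(T ^ 1) h‖ ^ 2
        + ‖(T ^ 0) h‖ ^ 2 := by
  have key (n : ℕ) : Integrable (fun x : ℝ≥0 => Q n x) (F.scalarMeasure h) ∧
      ‖(T ^ n) h‖ ^ 2 = ‖h‖ ^ 2 + n * (⟪h, B h⟫_ℂ).re + n ^ 2 * (⟪h, C h⟫_ℂ).re
        + ∫ x : ℝ≥0, Q n x ∂F.scalarMeasure h := by
    obtain ⟨A, hA, hT⟩ := hF.formula n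
    refine ⟨(hA h).1, ?_⟩
    have h1 := inner_adjoint_pow_mul_pow T n h
    rw [hT] at h1
    simp only [add_apply, one_apply_eq_self,
      smul_apply, inner_add_right, inner_smul_right, (hA h).2] at h1
    have h2 := congrArg Complex.re h1
    rw [inner_self_eq_norm_sq_to_K] at h2
    have h3 : ((n : ℂ) ^ 2) = ((n ^ 2 : ℝ) : ℂ) := by push_cast; rfl
    have h4 : (n : ℂ) = ((n : ℝ) : ℂ) := by push_cast; rfl
    have h5 : ((‖h‖ : ℂ) ^ 2) = ((‖h‖ ^ 2 : ℝ) : ℂ) := by push_cast; rfl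
    rw [h3, h4] at h2
    simp only [Complex.add_re, Complex.re_ofReal_mul, Complex.ofReal_re, Complex.coe_algebraMap,
      h5] at h2
    exact h2.symm
  have hdiff := integral_fourthDiff_Q (fun n => (key n).1) 0
  simp only [pow_zero, mul_one, zero_add] at hdiff
  refine ⟨hdiff.1, ?_⟩
  rw [hdiff.2]
  simp only [(key _).2]
  push_cast
  ring

/-! ### Moments of `ν` against the growth of `hat l`. -/

namespace IsScalarTriplet

variable {l : ℕ → ℝ} {b c : ℝ} {ν : Measure ℝ≥0}

/-- The fourth difference of `hat l` at `m` is `∫ (x - 1)² xᵐ dν`. -/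
theorem integral_sub_one_sq_mul_pow (hν : IsScalarTriplet l b c ν) (m : ℕ) :
    ∫ x : ℝ≥0, ((x : ℝ) - 1) ^ 2 * (x : ℝ) ^ m ∂ν =
      hat l (m + 4) - 4 * hat l (m + 3) + 6 * hat l (m + 2) - 4 * hat l (m + 1) + hat l m := by
  have := hν.finite
  rw [(integral_fourthDiff_Q (fun n => integrable_of_isCompact_support hν.compact_support
    ((continuous_Q n).comp NNReal.continuous_coe)) m).2]
  simp only [hν.formula]
  push_cast
  ring

theorem integrable_pow (hν : IsScalarTriplet l b c ν) (m : ℕ) :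
    Integrable (fun x : ℝ≥0 => (x : ℝ) ^ m) ν := by
  have := hν.finite
  exact integrable_of_isCompact_support hν.compact_support (by fun_prop)

/-- If `supp ν` reaches beyond `1`, then the moments of `ν` grow exponentially. -/
theorem exists_mul_pow_le_integral_pow (hν : IsScalarTriplet l b c ν)
    (hsup : 1 < sSup ν.support) :
    ∃ r δ : ℝ, 1 < r ∧ 0 < δ ∧ ∀ m : ℕ, δ * r ^ m ≤ ∫ x : ℝ≥0, (x : ℝ) ^ m ∂ν := by
  have := hν.finite
  have hne : ν.support.Nonempty := by
    -- In `ℝ≥0` the supremum of the empty set is `0`, contradicting `hsup`.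
    by_contra h
    simp [Set.not_nonempty_iff_eq_empty.1 h] at hsup
  obtain ⟨t, ht, h1t⟩ := exists_lt_of_lt_csSup hne hsup
  obtain ⟨r, h1r, hrt⟩ := exists_between h1t
  have hpos : 0 < ν (Set.Ioi r) :=
    (Measure.mem_support_iff_forall t).1 ht _ (Ioi_mem_nhds hrt)
  refine ⟨r, ν.real (Set.Ioi r), by exact_mod_cast h1r, ?_, fun m => ?_⟩
  · exact ENNReal.toReal_pos hpos.ne' (measure_ne_top _ _)
  · calc ν.real (Set.Ioi r) * (r : ℝ) ^ m = ∫ _ in Set.Ioi r, (r : ℝ) ^ m ∂ν := by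
          simp
      _ ≤ ∫ x in Set.Ioi r, (x : ℝ) ^ m ∂ν := by
          refine setIntegral_mono_on (integrable_const _).integrableOn
            (hν.integrable_pow m).integrableOn measurableSet_Ioi fun x hx => ?_
          have : r ≤ x := le_of_lt hx
          gcongr
      _ ≤ ∫ x : ℝ≥0, (x : ℝ) ^ m ∂ν :=
          setIntegral_le_integral (hν.integrable_pow m) (ae_of_all _ fun x => by positivity)

theorem exists_le_sub_one_sq (hone : (1 : ℝ≥0) ∉ ν.support) :
    ∃ ε : ℝ, 0 < ε ∧ ∀ᵐ x : ℝ≥0 ∂ν, ε ≤ ((x : ℝ) - 1) ^ 2 := by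
  obtain ⟨ε, hε, hball⟩ := Metric.isOpen_iff.1 Measure.isClosed_support.isOpen_compl 1 hone
  refine ⟨ε ^ 2, by positivity, ?_⟩
  filter_upwards [Measure.support_mem_ae (μ := ν)] with x hx
  by_contra! hlt
  refine hball ?_ hx
  rw [Metric.mem_ball, NNReal.dist_eq]
  exact abs_lt_of_sq_lt_sq hlt hε.le

/-- If `1` is off the support of `ν` and the support reaches beyond `1`, then `hat l m` is
dominated by the `m`-th moment of `ν`. -/
theorem exists_hat_le_mul_integral_pow (hν : IsScalarTriplet l b c ν)
    (hsup : 1 < sSup ν.support) (hone : (1 : ℝ≥0) ∉ ν.support) :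
    ∃ M : ℝ, 0 < M ∧ ∀ᶠ m : ℕ in atTop, hat l m ≤ M * ∫ x : ℝ≥0, (x : ℝ) ^ m ∂ν := by
  have := hν.finite
  obtain ⟨r, δ, hr, hδ, hrδ⟩ := hν.exists_mul_pow_le_integral_pow hsup
  obtain ⟨ε, hε, hae⟩ := exists_le_sub_one_sq hone
  -- The term `ε⁻¹` comes from `Q m x ≤ ε⁻¹ (xᵐ + m)`; the `1` absorbs the remaining quadratic in
  -- `m`, eventually below `δ rᵐ ≤ ∫ xᵐ dν`.
  refine ⟨1 + ε⁻¹, by positivity, ?_⟩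
  have hpoly : Tendsto (fun m : ℕ => ((1 : ℝ) + (b + ε⁻¹ * ν.real Set.univ) * m + c * (m : ℝ) ^ 2)
      / r ^ m) atTop (𝓝 0) := by
    have t (k : ℕ) := tendsto_pow_const_div_const_pow_of_one_lt k hr
    have := ((t 0).add ((t 1).const_mul (b + ε⁻¹ * ν.real Set.univ))).add ((t 2).const_mul c)
    simp only [mul_zero, add_zero] at this
    refine this.congr fun m => ?_
    ring
  filter_upwards [hpoly.eventually_lt_const hδ] with m hm
  have hrm : 0 < r ^ m := by positivity
  rw [div_lt_iff₀ hrm] at hm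
  have hQ : ∫ x : ℝ≥0, Q m x ∂ν ≤ ∫ x : ℝ≥0, ε⁻¹ * ((x : ℝ) ^ m + m) ∂ν := by
    refine integral_mono_ae (integrable_of_isCompact_support hν.compact_support
      ((continuous_Q m).comp NNReal.continuous_coe))
      (((hν.integrable_pow m).add (integrable_const _)).const_mul _) ?_
    filter_upwards [hae] with x hx
    have hsq := sq_mul_Q m (x : ℝ)
    have hx0 : (0 : ℝ) ≤ x := x.2
    have hxm : (0 : ℝ) ≤ m * x := by positivity
    have hm0 : (0 : ℝ) ≤ (x : ℝ) ^ m + m := by positivity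
    have hsq0 : 0 < ((x : ℝ) - 1) ^ 2 := hε.trans_le hx
    calc Q m x ≤ ((x : ℝ) ^ m + m) / ((x : ℝ) - 1) ^ 2 := by
          rw [le_div_iff₀ hsq0]
          linarith
      _ ≤ ((x : ℝ) ^ m + m) / ε := by gcongr
      _ = ε⁻¹ * ((x : ℝ) ^ m + m) := by ring
  rw [integral_const_mul, integral_add (hν.integrable_pow m) (integrable_const _), integral_const,
    smul_eq_mul] at hQ
  rw [hν.formula m]
  linarith [hrδ m]

end IsScalarTriplet

end CPDShift

/-! ### Lower bound for the diagonal of `F(ℝ₊)`. -/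

open CPDShift in
theorem mainTheorem12 (l : ℕ → ℝ) (hpos : ∀ n, 0 < l n) (hbdd : BddAbove (Set.range l))
    (hCPD : CPDShift.IsCPDOperator (CPDShift.weightedShift l hpos hbdd))
    (b c : ℝ) (ν : MeasureTheory.Measure NNReal) (hν : CPDShift.IsScalarTriplet l b c ν)
    (B C : CPDShift.Ell2 →L[ℂ] CPDShift.Ell2)
    (F : CPDShift.SemispectralMeasure NNReal CPDShift.Ell2)
    (hF : CPDShift.IsRepresentingTriplet (CPDShift.weightedShift l hpos hbdd) B C F)
    (hsup : 1 < sSup ν.support) (hone : (1 : NNReal) ∉ ν.support) :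
    ¬ IsCompactOperator (F Set.univ) := by
  have := hν.finite
  obtain ⟨M, hM, hhat⟩ := hν.exists_hat_le_mul_integral_pow hsup hone
  obtain ⟨ε, hε, hae⟩ := IsScalarTriplet.exists_le_sub_one_sq hone
  obtain ⟨R, hR⟩ := hF.compact_support.bddAbove
  have hK : (0 : ℝ) < ((R : ℝ) + 1) ^ 2 := by positivity
  -- Here `ε` bounds `(x - 1)²` from below `ν`-a.e., `M` compares `hat l m` with the moments, and
  -- `(R + 1)²` bounds `(x - 1)²` on the support of `F`.
  refine not_isCompactOperator_of_le_inner_e (δ := ε / M / ((R : ℝ) + 1) ^ 2) (by positivity) ?_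
  filter_upwards [hhat] with m hm
  have := F.isFiniteMeasure_scalarMeasure (e m)
  rw [F.inner_eq_scalarMeasure (e m) MeasurableSet.univ, Complex.ofReal_re, div_le_iff₀ hK,
    div_le_iff₀ hM]
  obtain ⟨hint, heq⟩ := hF.integral_sub_one_sq (e m)
  have hupper : ∫ x : ℝ≥0, ((x : ℝ) - 1) ^ 2 ∂F.scalarMeasure (e m)
      ≤ (F.scalarMeasure (e m)).real Set.univ * ((R : ℝ) + 1) ^ 2 := by
    rw [← smul_eq_mul, ← integral_const]
    refine integral_mono_ae hint (integrable_const _) ?_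
    filter_upwards [F.ae_mem_support (e m)] with x hx
    have hxR : (x : ℝ) ≤ R := hR hx
    have hx0 : (0 : ℝ) ≤ x := x.2
    have hR0 : (0 : ℝ) ≤ R := R.2
    exact sq_le_sq' (by linarith) (by linarith)
  have hlower : ε * ∫ x : ℝ≥0, (x : ℝ) ^ m ∂ν ≤ ∫ x : ℝ≥0, ((x : ℝ) - 1) ^ 2 * (x : ℝ) ^ m ∂ν := by
    rw [← integral_const_mul]
    refine integral_mono_ae ((hν.integrable_pow m).const_mul _)
      (integrable_of_isCompact_support hν.compact_support (by fun_prop)) ?_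
    filter_upwards [hae] with x hx
    gcongr
  have hrel : hat l m * ∫ x : ℝ≥0, ((x : ℝ) - 1) ^ 2 ∂F.scalarMeasure (e m)
      = ∫ x : ℝ≥0, ((x : ℝ) - 1) ^ 2 * (x : ℝ) ^ m ∂ν := by
    rw [heq, hν.integral_sub_one_sq_mul_pow]
    have N (n : ℕ) := norm_weightedShift_pow_e_sq l hpos hbdd n m
    -- The binomial coefficients of the fourth difference, with `N n` moving the factor `hat l m`
    -- inside each term.
    linear_combination N 4 - 4 * N 3 + 6 * N 2 - 4 * N 1 + N 0
  have hp := hat_pos hpos m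
  refine le_of_mul_le_mul_left ?_ hp
  calc hat l m * ε ≤ (M * ∫ x : ℝ≥0, (x : ℝ) ^ m ∂ν) * ε := by gcongr
    _ = M * (ε * ∫ x : ℝ≥0, (x : ℝ) ^ m ∂ν) := by ring
    _ ≤ M * (hat l m * ∫ x : ℝ≥0, ((x : ℝ) - 1) ^ 2 ∂F.scalarMeasure (e m)) := by
        rw [hrel]; gcongr
    _ ≤ M * (hat l m * ((F.scalarMeasure (e m)).real Set.univ * ((R : ℝ) + 1) ^ 2)) := by gcongr
    _ = _ := by ring
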